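/- Let $B_0,B_1$ be two real $d\times d$ Hurwitz matrices (all complex eigenvalues have negative real part) such that $B_i^T+B_i\le 0$ for $i=0,1$, that is $X^T(B_i^T+B_i)X\le 0$ for all $X\in\mathbb R^d$. The switched system $\dot X=B_{u(t)}X$ is called GUAS if for every measurable switching law $u:[0,+\infty)\to\{0,1\}$ and every initial condition $X(0)\in\mathbb R^d$ its solution (in integral form, $X(t)=X(0)+\int_0^tB_{u(s)}X(s)\,ds$) satisfies $X(t)\to 0$ as $t\to+\infty$. Let $\mathcal K=\ker(B_0^T+B_0)\cap\ker(B_1^T+B_1)$. For $\lambda\in[0,1]$ put $B_\lambda=(1-\lambda)B_0+\lambda B_1$, and let $A_\lambda:\mathcal K\to\mathcal K$ and $C_\lambda:\mathcal K\to\mathcal K^\perp$ be the compositions of $B_\lambda|_{\mathcal K}$ with the orthogonal projections of $\mathbb R^d$ onto $\mathcal K$ and onto $\mathcal K^\perp$, respectively. The pair $(C_\lambda,A_\lambda)$ is observable if for all $x_1\ne x_2$ in $\mathcal K$ there is $t\ge 0$ with $C_\lambda e^{tA_\lambda}x_1\neq C_\lambda e^{tA_\lambda}x_2$. Let $F=\{x\in\mathcal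 K:\ \exists\lambda\in[0,1],\ C_\lambda x=0\}$, $N=\ker C_0\cap\ker C_1$ and $F_0=F\setminus N$. For $x\in F_0$ let $\lambda(x)=\langle C_0x-C_1x,\,C_0x\rangle/\|C_0x-C_1x\|^2$, the unique $\lambda$ with $C_\lambda x=0$. Let $G$ be the set of points $x\in F$ with $\|x\|=1$ such that either - $x\in N$ and there is $\lambda\in[0,1]$ with $C_0A_\lambda x\wedge C_1x+C_0x\wedge C_1A_\lambda x=0$, or - $x\in F_0$ and $C_0A_{\lambda(x)}x\wedge C_1x+C_0x\wedge C_1A_{\lambda(x)}x=0$, where $\wedge$ is the exterior product in $\Lambda^2\mathcal K^\perp$. **Theorem.** The switched system is GUAS as soon as the pair $(C_\lambda,A_\lambda)$ is observable for every $\lambda\in[0,1]$ and one of the following conditions holds: 1. the set $G$ is discrete (every point of $G$ is isolated in $G$); 2. $\dim\mathcal K\le 2$. In particular, the switched system is GUAS if $\ker C_\lambda=\{0\}$ for every $\lambda\in[0,1]$. -/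

import Mathlib

open Filter Topology MeasureTheory Set
open scoped RealInnerProductSpace

namespace SwitchedSystem

/-- A real square matrix is Hurwitz if all its complex eigenvalues have negative real part. -/
def IsHurwitz {d : ℕ} (M : Matrix (Fin d) (Fin d) ℝ) : Prop :=
  ∀ z ∈ spectrum ℂ (M.map (algebraMap ℝ ℂ)), z.re < 0

/-- `Mᵀ + M ≤ 0`, i.e. the squared Euclidean norm is a (not necessarily strict) Lyapunov function
of the linear system with matrix `M`. -/
def IsDissipative {d : ℕ} (M : Matrix (Fin d) (Fin d) ℝ) : Prop :=
  ∀ X : EuclideanSpace ℝ (Fin d), ⟪X, Matrix.toEuclideanCLM (𝕜 := ℝ) (M.transpose + M) X⟫ ≤ 0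

section

variable {d : ℕ} (B : Fin 2 → Matrix (Fin d) (Fin d) ℝ)

/-- `x` solves `x' = B_{u(t)} x` on `[0, ∞)` (in the Carathéodory sense, i.e. in integral form).
Only the values of `u` and `x` on `[0, ∞)` matter. -/
def IsTrajectory (u : ℝ → Fin 2) (x : ℝ → EuclideanSpace ℝ (Fin d)) : Prop :=
  ContinuousOn x (Ici 0) ∧
    ∀ t, 0 ≤ t → x t = x 0 + ∫ s in (0 : ℝ)..t, Matrix.toEuclideanCLM (𝕜 := ℝ) (B (u s)) (x s)

/-- The switched system is GUAS: for every measurable switching law and every initial condition,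
the solution converges to `0`. -/
def IsGUAS : Prop :=
  ∀ u : ℝ → Fin 2, Measurable u →
    ∀ x : ℝ → EuclideanSpace ℝ (Fin d), IsTrajectory B u x → Tendsto x atTop (𝓝 0)

/-- The convexified matrix `B_l = (1 - l) B_0 + l B_1`. -/
def convexMatrix (l : ℝ) : Matrix (Fin d) (Fin d) ℝ := (1 - l) • B 0 + l • B 1

/-- `K = ker (B_0ᵀ + B_0) ∩ ker (B_1ᵀ + B_1)`. -/
noncomputable def K : Submodule ℝ (EuclideanSpace ℝ (Fin d)) :=
  (Matrix.toEuclideanCLM (𝕜 := ℝ) ((B 0).transpose + B 0)).ker ⊓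
    (Matrix.toEuclideanCLM (𝕜 := ℝ) ((B 1).transpose + B 1)).ker

/-- The block `A_l : K → K` of `B_l` in the orthogonal decomposition `ℝ^d = K ⊕ Kᗮ`. -/
noncomputable def A (l : ℝ) : K B →L[ℝ] K B :=
  (K B).orthogonalProjectionOnto ∘L Matrix.toEuclideanCLM (𝕜 := ℝ) (convexMatrix B l) ∘L (K B).subtypeL

/-- The block `C_l : K → Kᗮ` of `B_l` in the orthogonal decomposition `ℝ^d = K ⊕ Kᗮ`. -/
noncomputable def C (l : ℝ) : K B →L[ℝ] (K B)ᗮ :=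
  (K B)ᗮ.orthogonalProjectionOnto ∘L
    Matrix.toEuclideanCLM (𝕜 := ℝ) (convexMatrix B l) ∘L (K B).subtypeL

end

/-- The pair `(C, A)` is observable: the outputs `C x(t)` of the linear system `x' = A x`
distinguish any two different initial states. -/
def IsObservablePair {V W : Type*} [NormedAddCommGroup V] [NormedSpace ℝ V]
    [NormedAddCommGroup W] [NormedSpace ℝ W] (C : V →L[ℝ] W) (A : V →L[ℝ] V) : Prop :=
  ∀ x₁ x₂ : V, x₁ ≠ x₂ →
    ∃ t : ℝ, 0 ≤ t ∧ C (NormedSpace.exp (t • A) x₁) ≠ C (NormedSpace.exp (t • A) x₂)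

/-- The exterior product `v ∧ w` in the second exterior power. -/
noncomputable def wedge {W : Type*} [AddCommGroup W] [Module ℝ W] (v w : W) : ⋀[ℝ]^2 W :=
  exteriorPower.ιMulti ℝ 2 ![v, w]

section

variable {d : ℕ} (B : Fin 2 → Matrix (Fin d) (Fin d) ℝ)

/-- The cone `F` of the points `x` of `K` with `C_l x = 0` for some `l ∈ [0, 1]`. -/
def F : Set (K B) := {x | ∃ l ∈ Icc (0 : ℝ) 1, C B l x = 0}

/-- `N = ker C_0 ∩ ker C_1`. -/
def N : Set (K B) := {x | C B 0 x = 0 ∧ C B 1 x = 0}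

/-- `F_0 = F \ N`. -/
def F₀ : Set (K B) := F B \ N B

/-- For `x ∈ F_0`, the unique `l` such that `C_l x = 0`. -/
noncomputable def lam (x : K B) : ℝ :=
  ⟪C B 0 x - C B 1 x, C B 0 x⟫ / ‖C B 0 x - C B 1 x‖ ^ 2

/-- The bivector `C_0 A_l x ∧ C_1 x + C_0 x ∧ C_1 A_l x`. -/
noncomputable def tangency (l : ℝ) (x : K B) : ⋀[ℝ]^2 (K B)ᗮ :=
  wedge (C B 0 (A B l x)) (C B 1 x) + wedge (C B 0 x) (C B 1 (A B l x))

/-- The set `G` of the points of the unit sphere of `K` through which a trajectory with vanishing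
output can possibly pass. -/
def G : Set (K B) :=
  {x | x ∈ Metric.sphere (0 : K B) 1 ∩ F B ∧
    ((x ∈ N B ∧ ∃ l ∈ Icc (0 : ℝ) 1, tangency B l x = 0) ∨
      (x ∈ F₀ B ∧ tangency B (lam B x) x = 0))}

end

end SwitchedSystem

/-! Suppose some trajectory does not tend to `0`. Dissipativity makes its norm nonincreasing, with a
limit `r > 0`, and limits of time translates give a curve `y` on the whole line, contained in the
sphere of radius `r`, whose increments agree up to second order with those of the convexified system
(`IsDriven.exists_relaxedSolution`). No equation with a measurable control is needed for `y`: this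
estimate yields every derivative used later.

On a sphere, some admissible velocity is orthogonal to the position. If `⟪y, B₁ y⟫ ≠ 0` at some
time, the weight of `B₁` must vanish nearby, so `y` is locally an orbit of `B₀` on which `B₀ᵀ + B₀`
vanishes; differentiating repeatedly contradicts Hurwitz (`IsRelaxedSolution.inner_eq_zero`). By
symmetry `y` stays in `K`. Its velocity then has no `Kᗮ` component, so after normalization it stays
in `F`, and wherever `C₀ y ≠ C₁ y` the weight is determined and the velocity is `A_l y`
(`exists_isLimitCurve`).

It remains to exclude such limit curves. Under observability they are not constant. Differentiating
`C_λ z = 0` along the curve places it in `G` (`IsLimitCurve.mem_G`), so a discrete `G` would force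
it to be constant. If `dim K ≤ 2`, either `N ≠ 0` and `G` is finite, or some `w` lies outside `F`
and the speed of `⟪w, z⟫` is bounded away from zero, although `z` is bounded. If every `ker C_l` is
trivial, `F` contains no unit vector at all. -/

namespace SwitchedSystem

/-! ### Convexified dynamics and limits of time translates -/

section Relaxed

variable {V : Type*} [NormedAddCommGroup V] [InnerProductSpace ℝ V]

/-- The convex combination `(1 - l) T₀ + l T₁` of two operators. -/
noncomputable def mix (T₀ T₁ : V →L[ℝ] V) (l : ℝ) : V →L[ℝ] V := (1 - l) • T₀ + l • T₁

lemma mix_apply (T₀ T₁ : V →L[ℝ] V) (l : ℝ) (v : V) :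
    mix T₀ T₁ l v = (1 - l) • T₀ v + l • T₁ v := rfl

lemma norm_mix_apply_le {T₀ T₁ : V →L[ℝ] V} {b l : ℝ} (h₀ : ‖T₀‖ ≤ b) (h₁ : ‖T₁‖ ≤ b)
    (hl : l ∈ Icc (0 : ℝ) 1) (v : V) : ‖mix T₀ T₁ l v‖ ≤ b * ‖v‖ := by
  rw [mix_apply]
  have hl0 : 0 ≤ 1 - l := by linarith [hl.2]
  calc ‖(1 - l) • T₀ v + l • T₁ v‖ ≤ ‖(1 - l) • T₀ v‖ + ‖l • T₁ v‖ := norm_add_le _ _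
    _ = (1 - l) * ‖T₀ v‖ + l * ‖T₁ v‖ := by
      rw [norm_smul, norm_smul, Real.norm_of_nonneg hl0, Real.norm_of_nonneg hl.1]
    _ ≤ (1 - l) * (b * ‖v‖) + l * (b * ‖v‖) := by
      have e₀ := T₀.le_of_opNorm_le h₀ v
      have e₁ := T₁.le_of_opNorm_le h₁ v
      have := hl.1
      gcongr
    _ = b * ‖v‖ := by ring

/-- A curve whose increments are, up to second order, those of the convexified system. -/
def IsRelaxedSolution (T₀ T₁ : V →L[ℝ] V) (M : ℝ) (y : ℝ → V) : Prop :=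
  ∀ s σ : ℝ, ∃ l ∈ Icc (0 : ℝ) 1, ‖y σ - y s - (σ - s) • mix T₀ T₁ l (y s)‖ ≤ M * (σ - s) ^ 2

/-- Solution in integral form on `[0, ∞)` of the system driven by the weight `c`. -/
structure IsDriven (T₀ T₁ : V →L[ℝ] V) (c : ℝ → ℝ) (x : ℝ → V) : Prop where
  measurable : Measurable c
  mem_Icc : ∀ s, c s ∈ Icc (0 : ℝ) 1
  continuousOn : ContinuousOn x (Ici 0)
  eq_integral : ∀ t, 0 ≤ t → x t = x 0 + ∫ s in (0 : ℝ)..t, mix T₀ T₁ (c s) (x s)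

namespace IsDriven

variable {T₀ T₁ : V →L[ℝ] V} {c : ℝ → ℝ} {x : ℝ → V}

lemma intervalIntegrable_weight (h : IsDriven T₀ T₁ c x) (s σ : ℝ) :
    IntervalIntegrable c volume s σ := by
  refine (intervalIntegrable_const (c := (1 : ℝ))).mono_fun h.measurable.aestronglyMeasurable ?_
  refine ae_of_all _ fun t => ?_
  simpa [abs_of_nonneg (h.mem_Icc t).1] using (h.mem_Icc t).2

lemma intervalIntegrable (h : IsDriven T₀ T₁ c x) {f : ℝ → V} {s σ : ℝ}
    (hf : ContinuousOn f (uIcc s σ)) :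
    IntervalIntegrable (fun τ => mix T₀ T₁ (c τ) (f τ)) volume s σ := by
  have h₁ : IntervalIntegrable (fun τ => c τ • (T₁ (f τ) - T₀ (f τ))) volume s σ :=
    (h.intervalIntegrable_weight s σ).smul_continuousOn (by fun_prop)
  have h₀ : IntervalIntegrable (fun τ => T₀ (f τ)) volume s σ :=
    ContinuousOn.intervalIntegrable (by fun_prop)
  refine (h₀.add h₁).congr (fun τ _ => ?_)
  simp only [mix_apply]
  module

lemma uIcc_subset {s σ : ℝ} (hs : 0 ≤ s) (hσ : 0 ≤ σ) : uIcc s σ ⊆ Ici (0 : ℝ) :=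
  fun _ ht => (le_min hs hσ).trans ht.1

lemma sub_eq_integral (h : IsDriven T₀ T₁ c x) {s σ : ℝ} (hs : 0 ≤ s) (hσ : 0 ≤ σ) :
    x σ - x s = ∫ τ in s..σ, mix T₀ T₁ (c τ) (x τ) := by
  have hi : ∀ t, 0 ≤ t → IntervalIntegrable (fun τ => mix T₀ T₁ (c τ) (x τ)) volume 0 t :=
    fun t ht => h.intervalIntegrable (h.continuousOn.mono (uIcc_subset le_rfl ht))
  rw [h.eq_integral σ hσ, h.eq_integral s hs, add_sub_add_left_eq_sub,
    intervalIntegral.integral_interval_sub_left (hi σ hσ) (hi s hs)]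

lemma norm_sub_le (h : IsDriven T₀ T₁ c x) {b R s σ : ℝ} (h₀ : ‖T₀‖ ≤ b) (h₁ : ‖T₁‖ ≤ b)
    (hs : 0 ≤ s) (hσ : 0 ≤ σ) (hR : ∀ τ ∈ uIcc s σ, ‖x τ‖ ≤ R) :
    ‖x σ - x s‖ ≤ b * R * |σ - s| := by
  have hb : 0 ≤ b := (norm_nonneg _).trans h₀
  rw [h.sub_eq_integral hs hσ]
  refine intervalIntegral.norm_integral_le_of_norm_le_const fun τ hτ => ?_
  exact (norm_mix_apply_le h₀ h₁ (h.mem_Icc τ) _).trans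
    (mul_le_mul_of_nonneg_left (hR τ (uIoc_subset_uIcc hτ)) hb)

/-- Freezing the state at `x s` leaves only the mean weight over the interval, and the error is a
Lipschitz bound integrated once more. Both time orders are allowed, because the limit curve is
estimated in both directions. -/
lemma exists_norm_sub_sub_smul_le [CompleteSpace V] (h : IsDriven T₀ T₁ c x) {b R s σ : ℝ}
    (h₀ : ‖T₀‖ ≤ b) (h₁ : ‖T₁‖ ≤ b) (hs : 0 ≤ s) (hσ : 0 ≤ σ) (hR : ∀ τ ∈ uIcc s σ, ‖x τ‖ ≤ R) :
    ∃ l ∈ Icc (0 : ℝ) 1,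
      ‖x σ - x s - (σ - s) • mix T₀ T₁ l (x s)‖ ≤ b ^ 2 * R * (σ - s) ^ 2 := by
  have hb : 0 ≤ b := (norm_nonneg _).trans h₀
  have hR0 : 0 ≤ R := (norm_nonneg _).trans (hR s left_mem_uIcc)
  rcases eq_or_ne s σ with rfl | hne
  · exact ⟨0, by simp, by simp⟩
  have hne' : σ - s ≠ 0 := sub_ne_zero.2 hne.symm
  have hcont : ContinuousOn x (uIcc s σ) := h.continuousOn.mono (uIcc_subset hs hσ)
  -- The mean of the weight: the frozen velocity is affine in `c`, so its integral is exactly the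
  -- increment with this constant weight.
  set l : ℝ := (σ - s)⁻¹ * ∫ τ in s..σ, c τ with hl
  have hmul : (σ - s) * l = ∫ τ in s..σ, c τ := by rw [hl, mul_inv_cancel_left₀ hne']
  have hci := h.intervalIntegrable_weight s σ
  have hmem : l ∈ Icc (0 : ℝ) 1 := by
    rcases lt_or_gt_of_ne hne with hlt | hlt
    · have e₀ : 0 ≤ ∫ τ in s..σ, c τ :=
        intervalIntegral.integral_nonneg hlt.le fun τ _ => (h.mem_Icc τ).1
      have e₁ : ∫ τ in s..σ, c τ ≤ ∫ _ in s..σ, (1 : ℝ) :=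
        intervalIntegral.integral_mono_on hlt.le hci intervalIntegrable_const
          fun τ _ => (h.mem_Icc τ).2
      simp only [intervalIntegral.integral_const, smul_eq_mul, mul_one] at e₁
      rw [← hmul] at e₀ e₁
      have hp : 0 < σ - s := by linarith
      exact ⟨by nlinarith, by nlinarith⟩
    · have e₀ : 0 ≤ ∫ τ in σ..s, c τ :=
        intervalIntegral.integral_nonneg hlt.le fun τ _ => (h.mem_Icc τ).1
      have e₁ : ∫ τ in σ..s, c τ ≤ ∫ _ in σ..s, (1 : ℝ) :=
        intervalIntegral.integral_mono_on hlt.le hci.symm intervalIntegrable_const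
          fun τ _ => (h.mem_Icc τ).2
      simp only [intervalIntegral.integral_const, smul_eq_mul, mul_one] at e₁
      rw [intervalIntegral.integral_symm, ← hmul] at e₀ e₁
      have hp : 0 < s - σ := by linarith
      exact ⟨by nlinarith, by nlinarith⟩
  refine ⟨l, hmem, ?_⟩
  have key : (σ - s) • mix T₀ T₁ l (x s) = ∫ τ in s..σ, mix T₀ T₁ (c τ) (x s) := by
    have e : ∀ τ, mix T₀ T₁ (c τ) (x s) = T₀ (x s) + c τ • (T₁ (x s) - T₀ (x s)) := by
      intro τ; rw [mix_apply]; module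
    simp only [e]
    rw [intervalIntegral.integral_add intervalIntegrable_const (hci.smul_continuousOn (by fun_prop)),
      intervalIntegral.integral_smul_const, intervalIntegral.integral_const, ← hmul, mix_apply]
    module
  rw [key, h.sub_eq_integral hs hσ,
    ← intervalIntegral.integral_sub (h.intervalIntegrable hcont)
      (h.intervalIntegrable continuousOn_const)]
  have hbound : ∀ τ ∈ uIoc s σ,
      ‖mix T₀ T₁ (c τ) (x τ) - mix T₀ T₁ (c τ) (x s)‖ ≤ b * (b * R * |σ - s|) := by
    intro τ hτ
    have hτ' := uIoc_subset_uIcc hτ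
    rw [← map_sub]
    refine (norm_mix_apply_le h₀ h₁ (h.mem_Icc τ) _).trans (mul_le_mul_of_nonneg_left ?_ hb)
    refine (h.norm_sub_le h₀ h₁ hs (uIcc_subset hs hσ hτ')
      fun ρ hρ => hR ρ (uIcc_subset_uIcc_left hτ' hρ)).trans ?_
    exact mul_le_mul_of_nonneg_left (abs_sub_left_of_mem_uIcc hτ') (mul_nonneg hb hR0)
  refine (intervalIntegral.norm_integral_le_of_norm_le_const hbound).trans (le_of_eq ?_)
  rw [← sq_abs (σ - s)]
  ring

/-- The first-order term of the squared norm is nonpositive by dissipativity. Only a quadratic error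
remains, which subdivision removes, so the norm need not be differentiated almost everywhere. -/
lemma sq_norm_le_add [CompleteSpace V] (h : IsDriven T₀ T₁ c x) {b R s σ : ℝ}
    (hd₀ : ∀ v, ⟪v, T₀ v⟫ ≤ 0) (hd₁ : ∀ v, ⟪v, T₁ v⟫ ≤ 0)
    (h₀ : ‖T₀‖ ≤ b) (h₁ : ‖T₁‖ ≤ b) (hs : 0 ≤ s) (hsσ : s ≤ σ)
    (hR : ∀ τ ∈ uIcc s σ, ‖x τ‖ ≤ R) :
    ‖x σ‖ ^ 2 ≤ ‖x s‖ ^ 2 + 3 * (b * R) ^ 2 * (σ - s) ^ 2 := by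
  obtain ⟨l, hl, hle⟩ := h.exists_norm_sub_sub_smul_le h₀ h₁ hs (hs.trans hsσ) hR
  have hn := h.norm_sub_le h₀ h₁ hs (hs.trans hsσ) hR
  have hR0 : ‖x s‖ ≤ R := hR s left_mem_uIcc
  have hsq : ‖x σ - x s‖ ^ 2 ≤ (b * R) ^ 2 * (σ - s) ^ 2 := by
    calc ‖x σ - x s‖ ^ 2 ≤ (b * R * |σ - s|) ^ 2 := by gcongr
      _ = _ := by rw [mul_pow, sq_abs]
  have hdis : ⟪x s, mix T₀ T₁ l (x s)⟫ ≤ 0 := by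
    rw [mix_apply, inner_add_right, inner_smul_right, inner_smul_right]
    nlinarith [hd₀ (x s), hd₁ (x s), hl.1, hl.2]
  have hcs := real_inner_le_norm (x s) (x σ - x s - (σ - s) • mix T₀ T₁ l (x s))
  rw [inner_sub_right, inner_smul_right] at hcs
  have hprod : ‖x s‖ * ‖x σ - x s - (σ - s) • mix T₀ T₁ l (x s)‖
      ≤ R * (b ^ 2 * R * (σ - s) ^ 2) :=
    mul_le_mul hR0 hle (norm_nonneg _) ((norm_nonneg _).trans hR0)
  have hexp : ‖x σ‖ ^ 2 = ‖x s‖ ^ 2 + 2 * ⟪x s, x σ - x s⟫ + ‖x σ - x s‖ ^ 2 := by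
    rw [← norm_add_sq_real, add_sub_cancel]
  have hneg : (σ - s) * ⟪x s, mix T₀ T₁ l (x s)⟫ ≤ 0 :=
    mul_nonpos_of_nonneg_of_nonpos (by linarith) hdis
  nlinarith

end IsDriven

/-- A function whose increments to the right are at most quadratic is nonincreasing. -/
lemma le_of_forall_le_add_sq {f : ℝ → ℝ} {k s t : ℝ} (hst : s ≤ t)
    (hf : ∀ a b, s ≤ a → a ≤ b → b ≤ t → f b ≤ f a + k * (b - a) ^ 2) : f t ≤ f s := by
  have hn : ∀ n : ℕ, f t - f s ≤ k * (t - s) ^ 2 * (1 / ((n : ℝ) + 1)) := by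
    intro n
    -- With `n + 1` equal steps the quadratic errors add up to `O(1 / (n + 1))`.
    set δ : ℝ := (t - s) / (n + 1) with hδ
    have hpos : (0 : ℝ) < n + 1 := by positivity
    have hδ0 : 0 ≤ δ := div_nonneg (by linarith) hpos.le
    have hδn : (n + 1) * δ = t - s := by rw [hδ]; field_simp
    have hi : ∀ m : ℕ, m ≤ n + 1 → f (s + m * δ) ≤ f s + m * (k * δ ^ 2) := by
      intro m
      induction m with
      | zero => simp
      | succ m ih =>
        intro hm
        have hm' : (m : ℝ) + 1 ≤ n + 1 := by exact_mod_cast hm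
        have h1 := ih (by omega)
        have h2 := hf (s + m * δ) (s + (m + 1 : ℕ) * δ)
          (by have : 0 ≤ (m : ℝ) * δ := by positivity
              linarith) (by push_cast; nlinarith) (by push_cast; nlinarith)
        have h3 : s + ((m + 1 : ℕ) : ℝ) * δ - (s + m * δ) = δ := by push_cast; ring
        rw [h3] at h2
        push_cast at h2 ⊢
        linarith
    have h := hi (n + 1) le_rfl
    have e1 : s + ((n + 1 : ℕ) : ℝ) * δ = t := by push_cast; linarith
    have e2 : ((n + 1 : ℕ) : ℝ) * (k * δ ^ 2) = k * (t - s) ^ 2 * (1 / ((n : ℝ) + 1)) := by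
      rw [hδ]; push_cast; field_simp
    rw [e1, e2] at h
    linarith
  have hlim : Tendsto (fun n : ℕ => k * (t - s) ^ 2 * (1 / ((n : ℝ) + 1))) atTop (𝓝 0) := by
    simpa using tendsto_one_div_add_atTop_nhds_zero_nat.const_mul (k * (t - s) ^ 2)
  linarith [ge_of_tendsto' hlim hn]

namespace IsDriven

variable {T₀ T₁ : V →L[ℝ] V} {c : ℝ → ℝ} {x : ℝ → V}

lemma norm_antitoneOn [CompleteSpace V] (h : IsDriven T₀ T₁ c x)
    (hd₀ : ∀ v, ⟪v, T₀ v⟫ ≤ 0) (hd₁ : ∀ v, ⟪v, T₁ v⟫ ≤ 0) :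
    AntitoneOn (fun t => ‖x t‖) (Ici 0) := by
  intro s hs t _ hst
  obtain ⟨R, hR⟩ := (isCompact_Icc (a := s) (b := t)).exists_bound_of_continuousOn
    (h.continuousOn.mono fun τ hτ => le_trans hs hτ.1)
  have := le_of_forall_le_add_sq (f := fun τ => ‖x τ‖ ^ 2) hst fun a a' ha haa' ha' =>
    h.sq_norm_le_add hd₀ hd₁ (le_max_left ‖T₀‖ ‖T₁‖) (le_max_right _ _) (le_trans hs ha) haa'
      fun τ hτ => hR τ (by rw [uIcc_of_le haa'] at hτ; exact ⟨ha.trans hτ.1, hτ.2.trans ha'⟩)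
  exact (sq_le_sq₀ (norm_nonneg _) (norm_nonneg _)).1 this

/-- A trajectory that does not tend to `0` has a limit trajectory on a sphere. -/
theorem exists_relaxedSolution [FiniteDimensional ℝ V] (h : IsDriven T₀ T₁ c x)
    (hd₀ : ∀ v, ⟪v, T₀ v⟫ ≤ 0) (hd₁ : ∀ v, ⟪v, T₁ v⟫ ≤ 0) (hx : ¬ Tendsto x atTop (𝓝 0)) :
    ∃ (y : ℝ → V) (r M : ℝ), 0 < r ∧ (∀ s, ‖y s‖ = r) ∧ IsRelaxedSolution T₀ T₁ M y := by
  have : CompleteSpace V := FiniteDimensional.complete ℝ V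
  have : ProperSpace V := FiniteDimensional.proper ℝ V
  have hanti := h.norm_antitoneOn hd₀ hd₁
  have hbd : ∀ t, 0 ≤ t → ‖x t‖ ≤ ‖x 0‖ := fun t ht => hanti (mem_Ici.2 le_rfl) ht ht
  obtain ⟨r, hr⟩ : ∃ r, Tendsto (fun t => ‖x t‖) atTop (𝓝 r) := by
    have hanti' : Antitone fun t => ‖x (max t 0)‖ := fun a b hab =>
      hanti (le_max_right a 0) (le_max_right b 0) (max_le_max_right 0 hab)
    refine ⟨_, (tendsto_atTop_ciInf hanti' ⟨0, ?_⟩).congr' ?_⟩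
    · rintro _ ⟨t, rfl⟩; exact norm_nonneg _
    · filter_upwards [eventually_ge_atTop 0] with t ht
      rw [max_eq_left ht]
  have hr0 : 0 < r := by
    refine lt_of_le_of_ne (ge_of_tendsto' hr fun t => norm_nonneg _) ?_
    rintro rfl
    exact hx (tendsto_zero_iff_norm_tendsto_zero.2 hr)
  -- An ultrafilter finer than `atTop` makes all translates converge pointwise at once, in place of
  -- Arzelà–Ascoli and extraction of subsequences.
  let U : Ultrafilter ℝ := Ultrafilter.of atTop
  have hU : (U : Filter ℝ) ≤ atTop := Ultrafilter.of_le _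
  have hshift : ∀ s : ℝ, Tendsto (fun t => t + s) U atTop := fun s =>
    (tendsto_atTop_add_const_right atTop s tendsto_id).mono_left hU
  have hpos : ∀ s : ℝ, ∀ᶠ t in (U : Filter ℝ), 0 ≤ t + s := fun s =>
    (hshift s).eventually (eventually_ge_atTop 0)
  have hy : ∀ s : ℝ, ∃ v, Tendsto (fun t => x (t + s)) U (𝓝 v) := by
    intro s
    obtain ⟨v, -, hv⟩ := (isCompact_closedBall (0 : V) ‖x 0‖).ultrafilter_le_nhds
      (U.map fun t => x (t + s)) (by
        rw [le_principal_iff, Ultrafilter.coe_map, mem_map]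
        filter_upwards [hpos s] with t ht
        simpa using hbd _ ht)
    exact ⟨v, hv⟩
  choose y hy using hy
  set b := max ‖T₀‖ ‖T₁‖ with hb
  refine ⟨y, r, b ^ 2 * ‖x 0‖, hr0, fun s => ?_, fun s σ => ?_⟩
  · exact tendsto_nhds_unique (hy s).norm (hr.comp (hshift s))
  -- The implications let `l` be chosen for every `t`, with default `0` where a shifted time is
  -- negative; these `t` are negligible for `U`.
  · have hex : ∀ t, ∃ l ∈ Icc (0 : ℝ) 1, 0 ≤ t + s → 0 ≤ t + σ →
        ‖x (t + σ) - x (t + s) - (σ - s) • mix T₀ T₁ l (x (t + s))‖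
          ≤ b ^ 2 * ‖x 0‖ * (σ - s) ^ 2 := by
      intro t
      by_cases hs : 0 ≤ t + s
      · by_cases hσ : 0 ≤ t + σ
        · obtain ⟨l, hl, hle⟩ := h.exists_norm_sub_sub_smul_le (b := b) (le_max_left ‖T₀‖ ‖T₁‖)
            (le_max_right _ _) hs hσ fun τ hτ => hbd τ (uIcc_subset hs hσ hτ)
          exact ⟨l, hl, fun _ _ => by simpa using hle⟩
        · exact ⟨0, by simp, fun _ h => absurd h hσ⟩
      · exact ⟨0, by simp, fun h => absurd h hs⟩
    choose l hl hle using hex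
    obtain ⟨m, hm, hlm⟩ := (isCompact_Icc (a := (0 : ℝ)) (b := 1)).ultrafilter_le_nhds (U.map l)
      (by rw [le_principal_iff, Ultrafilter.coe_map, mem_map]; exact Eventually.of_forall hl)
    have hlm' : Tendsto l U (𝓝 m) := hlm
    refine ⟨m, hm, ?_⟩
    have hlim : Tendsto (fun t => ‖x (t + σ) - x (t + s) - (σ - s) • mix T₀ T₁ (l t) (x (t + s))‖)
        U (𝓝 ‖y σ - y s - (σ - s) • mix T₀ T₁ m (y s)‖) := by
      simp only [mix_apply]
      have e₀ := (T₀.continuous.tendsto (y s)).comp (hy s)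
      have e₁ := (T₁.continuous.tendsto (y s)).comp (hy s)
      exact (((hy σ).sub (hy s)).sub
        ((((tendsto_const_nhds.sub hlm').smul e₀).add (hlm'.smul e₁)).const_smul _)).norm
    refine le_of_tendsto hlim ?_
    filter_upwards [hpos s, hpos σ] with t hs hσ using hle t hs hσ

end IsDriven

namespace IsRelaxedSolution

variable {T₀ T₁ : V →L[ℝ] V} {M : ℝ} {y : ℝ → V}

lemma swap (h : IsRelaxedSolution T₀ T₁ M y) : IsRelaxedSolution T₁ T₀ M y := by
  intro s σ
  obtain ⟨l, hl, hle⟩ := h s σ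
  refine ⟨1 - l, ⟨by linarith [hl.2], by linarith [hl.1]⟩, ?_⟩
  have : mix T₁ T₀ (1 - l) (y s) = mix T₀ T₁ l (y s) := by simp only [mix_apply]; module
  rwa [this]

lemma smul (h : IsRelaxedSolution T₀ T₁ M y) (k : ℝ) :
    IsRelaxedSolution T₀ T₁ (|k| * M) fun s => k • y s := by
  intro s σ
  obtain ⟨l, hl, hle⟩ := h s σ
  refine ⟨l, hl, ?_⟩
  have : k • y σ - k • y s - (σ - s) • mix T₀ T₁ l (k • y s)
      = k • (y σ - y s - (σ - s) • mix T₀ T₁ l (y s)) := by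
    rw [map_smul]; module
  rw [this, norm_smul, Real.norm_eq_abs, mul_assoc]
  exact mul_le_mul_of_nonneg_left hle (abs_nonneg k)

lemma exists_tendsto_slope (h : IsRelaxedSolution T₀ T₁ M y) (s : ℝ) :
    ∃ l : ℝ → ℝ, (∀ σ, l σ ∈ Icc (0 : ℝ) 1) ∧
      Tendsto (fun σ => slope y s σ - mix T₀ T₁ (l σ) (y s)) (𝓝[≠] s) (𝓝 0) := by
  choose l hl hle using h s
  refine ⟨l, hl, ?_⟩
  have hz : Tendsto (fun σ => M * |σ - s|) (𝓝[≠] s) (𝓝 0) := by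
    have : ContinuousAt (fun σ => M * |σ - s|) s := by fun_prop
    have h2 := this.tendsto
    simp only [sub_self, abs_zero, mul_zero] at h2
    exact h2.mono_left nhdsWithin_le_nhds
  refine squeeze_zero_norm' ?_ hz
  filter_upwards [self_mem_nhdsWithin] with σ hσ
  have hne : σ - s ≠ 0 := sub_ne_zero.2 hσ
  have e : slope y s σ - mix T₀ T₁ (l σ) (y s)
      = (σ - s)⁻¹ • (y σ - y s - (σ - s) • mix T₀ T₁ (l σ) (y s)) := by
    rw [smul_sub, inv_smul_smul₀ hne, slope_def_module]
  rw [e, norm_smul, norm_inv, Real.norm_eq_abs, inv_mul_le_iff₀ (abs_pos.2 hne)]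
  refine (hle σ).trans (le_of_eq ?_)
  rw [← sq_abs]; ring

lemma exists_norm_sub_le (h : IsRelaxedSolution T₀ T₁ M y) (s : ℝ) :
    ∃ b, ∀ σ, ‖y σ - y s‖ ≤ |σ - s| * (|M| * |σ - s| + b) := by
  refine ⟨max ‖T₀‖ ‖T₁‖ * ‖y s‖, fun σ => ?_⟩
  obtain ⟨l, hl, hle⟩ := h s σ
  have e : y σ - y s = (y σ - y s - (σ - s) • mix T₀ T₁ l (y s))
      + (σ - s) • mix T₀ T₁ l (y s) := by abel
  have h1 : M * (σ - s) ^ 2 ≤ |M| * |σ - s| ^ 2 := by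
    rw [sq_abs]
    exact mul_le_mul_of_nonneg_right (le_abs_self M) (sq_nonneg _)
  have h2 : ‖(σ - s) • mix T₀ T₁ l (y s)‖ ≤ |σ - s| * (max ‖T₀‖ ‖T₁‖ * ‖y s‖) := by
    rw [norm_smul, Real.norm_eq_abs]
    exact mul_le_mul_of_nonneg_left
      (norm_mix_apply_le (le_max_left _ _) (le_max_right _ _) hl _) (abs_nonneg _)
  rw [e]
  linarith [norm_add_le (y σ - y s - (σ - s) • mix T₀ T₁ l (y s)) ((σ - s) • mix T₀ T₁ l (y s))]

lemma continuous (h : IsRelaxedSolution T₀ T₁ M y) : Continuous y := by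
  rw [continuous_iff_continuousAt]
  intro s
  obtain ⟨b, hb⟩ := h.exists_norm_sub_le s
  rw [ContinuousAt, tendsto_iff_norm_sub_tendsto_zero]
  have hz : Tendsto (fun σ => |σ - s| * (|M| * |σ - s| + b)) (𝓝 s) (𝓝 0) := by
    have : ContinuousAt (fun σ => |σ - s| * (|M| * |σ - s| + b)) s := by fun_prop
    simpa using this.tendsto
  exact squeeze_zero (fun _ => norm_nonneg _) hb hz

variable {W : Type*} [NormedAddCommGroup W] [NormedSpace ℝ W]

lemma tendsto_mix (g : V →L[ℝ] W) {w : W} {s : ℝ} {l : ℝ → ℝ}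
    (hg : HasDerivAt (fun t => g (y t)) w s)
    (hl : Tendsto (fun σ => slope y s σ - mix T₀ T₁ (l σ) (y s)) (𝓝[≠] s) (𝓝 0)) :
    Tendsto (fun σ => g (mix T₀ T₁ (l σ) (y s))) (𝓝[≠] s) (𝓝 w) := by
  have h1 := hasDerivAt_iff_tendsto_slope.1 hg
  have h2 := (g.continuous.tendsto 0).comp hl
  rw [map_zero] at h2
  have h3 := h1.sub h2
  rw [sub_zero] at h3
  refine h3.congr fun σ => ?_
  simp only [Function.comp_apply, map_sub, slope_def_module, map_smul]
  abel

/-- If a linear image of a relaxed solution is differentiable, its derivative is the image of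
an admissible velocity. -/
lemma exists_mix_eq (h : IsRelaxedSolution T₀ T₁ M y) (g : V →L[ℝ] W) {w : W} {s : ℝ}
    (hg : HasDerivAt (fun t => g (y t)) w s) :
    ∃ l ∈ Icc (0 : ℝ) 1, g (mix T₀ T₁ l (y s)) = w := by
  obtain ⟨l, hl, hlim⟩ := h.exists_tendsto_slope s
  have hg' := tendsto_mix g hg hlim
  have hK : IsCompact ((fun m => g (mix T₀ T₁ m (y s))) '' Icc (0 : ℝ) 1) := by
    refine isCompact_Icc.image ?_
    simp only [mix_apply]
    fun_prop
  have := hK.isClosed.mem_of_tendsto hg' (Eventually.of_forall fun σ => ⟨l σ, hl σ, rfl⟩)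
  simpa using this

/-- If a linear image of a relaxed solution is differentiable and the admissible velocity is
determined by its image, then the solution itself is differentiable. -/
lemma hasDerivAt_of_ne (h : IsRelaxedSolution T₀ T₁ M y) (g : V →L[ℝ] W) {w : W} {s m : ℝ}
    (hg : HasDerivAt (fun t => g (y t)) w s) (hne : g (T₀ (y s)) ≠ g (T₁ (y s)))
    (hm : g (mix T₀ T₁ m (y s)) = w) : HasDerivAt y (mix T₀ T₁ m (y s)) s := by
  obtain ⟨l, hl, hlim⟩ := h.exists_tendsto_slope s
  have hg' := tendsto_mix g hg hlim
  -- The image under `g` is affine in the weight with nonzero slope, so convergence of the images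
  -- forces convergence of the weights.
  have hlm : Tendsto l (𝓝[≠] s) (𝓝 m) := by
    have hD : 0 < ‖g (T₁ (y s)) - g (T₀ (y s))‖ := norm_pos_iff.2 (sub_ne_zero.2 hne.symm)
    rw [tendsto_iff_norm_sub_tendsto_zero] at hg' ⊢
    have h3 := hg'.mul_const (‖g (T₁ (y s)) - g (T₀ (y s))‖⁻¹)
    rw [zero_mul] at h3
    refine h3.congr fun σ => ?_
    have e : g (mix T₀ T₁ (l σ) (y s)) - w = (l σ - m) • (g (T₁ (y s)) - g (T₀ (y s))) := by
      rw [← hm]; simp only [mix_apply, map_add, map_smul]; module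
    rw [e, norm_smul, mul_inv_cancel_right₀ hD.ne']
  rw [hasDerivAt_iff_tendsto_slope]
  have h4 : Tendsto (fun σ => mix T₀ T₁ (l σ) (y s)) (𝓝[≠] s) (𝓝 (mix T₀ T₁ m (y s))) := by
    simp only [mix_apply]
    exact ((tendsto_const_nhds.sub hlm).smul_const _).add (hlm.smul_const _)
  have h5 := hlim.add h4
  rw [zero_add] at h5
  exact h5.congr fun σ => by abel

/-- A relaxed solution on a sphere moves orthogonally to its position. -/
lemma hasDerivAt_inner_self (h : IsRelaxedSolution T₀ T₁ M y) {r : ℝ} (hr : ∀ s, ‖y s‖ = r)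
    (s : ℝ) : HasDerivAt (fun t => innerSL ℝ (y s) (y t)) 0 s := by
  obtain ⟨b, hb⟩ := h.exists_norm_sub_le s
  rw [hasDerivAt_iff_tendsto_slope]
  have hz : Tendsto (fun σ => |σ - s| * (|M| * |σ - s| + b) ^ 2 / 2) (𝓝[≠] s) (𝓝 0) := by
    have : ContinuousAt (fun σ => |σ - s| * (|M| * |σ - s| + b) ^ 2 / 2) s := by fun_prop
    have h2 := this.tendsto
    simp only [sub_self, abs_zero, zero_mul, zero_div] at h2
    exact h2.mono_left nhdsWithin_le_nhds
  refine squeeze_zero_norm' ?_ hz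
  filter_upwards [self_mem_nhdsWithin] with σ hσ
  have habs : 0 < |σ - s| := abs_pos.2 (sub_ne_zero.2 hσ)
  -- Polarization on a sphere turns the radial increment into a squared distance, which is of second
  -- order.
  have e : ⟪y s, y σ⟫ - ⟪y s, y s⟫ = -(‖y σ - y s‖ ^ 2 / 2) := by
    have := norm_sub_sq_real (y σ) (y s)
    rw [hr, hr, real_inner_comm] at this
    rw [real_inner_self_eq_norm_sq, hr]
    linarith
  simp only [slope_def_module, innerSL_apply_apply]
  rw [e, norm_smul, norm_inv, norm_neg, Real.norm_eq_abs, Real.norm_of_nonneg (by positivity),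
    inv_mul_le_iff₀ habs]
  have := pow_le_pow_left₀ (norm_nonneg _) (hb σ) 2
  linarith

end IsRelaxedSolution

end Relaxed

/-! ### Dissipative and Hurwitz matrices -/

section Dissipative

variable {d : ℕ} {M : Matrix (Fin d) (Fin d) ℝ}

lemma inner_toEuclideanCLM_transpose (M : Matrix (Fin d) (Fin d) ℝ)
    (x y : EuclideanSpace ℝ (Fin d)) :
    ⟪x, Matrix.toEuclideanCLM (𝕜 := ℝ) M.transpose y⟫
      = ⟪Matrix.toEuclideanCLM (𝕜 := ℝ) M x, y⟫ := by
  have : Matrix.toEuclideanCLM (𝕜 := ℝ) M.transpose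
      = ContinuousLinearMap.adjoint (Matrix.toEuclideanCLM (𝕜 := ℝ) M) := by
    rw [← ContinuousLinearMap.star_eq_adjoint, ← map_star, Matrix.star_eq_conjTranspose,
      Matrix.conjTranspose_eq_transpose_of_trivial]
  rw [this, ContinuousLinearMap.adjoint_inner_right]

lemma inner_toEuclideanCLM_transpose_add (M : Matrix (Fin d) (Fin d) ℝ)
    (x y : EuclideanSpace ℝ (Fin d)) :
    ⟪x, Matrix.toEuclideanCLM (𝕜 := ℝ) (M.transpose + M) y⟫
      = ⟪Matrix.toEuclideanCLM (𝕜 := ℝ) M x, y⟫ + ⟪x, Matrix.toEuclideanCLM (𝕜 := ℝ) M y⟫ := by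
  rw [map_add, add_apply, inner_add_right, inner_toEuclideanCLM_transpose]

lemma IsDissipative.inner_nonpos (h : IsDissipative M) (x : EuclideanSpace ℝ (Fin d)) :
    ⟪x, Matrix.toEuclideanCLM (𝕜 := ℝ) M x⟫ ≤ 0 := by
  have := h x
  rw [inner_toEuclideanCLM_transpose_add, real_inner_comm] at this
  linarith

/-- An isotropic vector maximizes the nonpositive form of `S = Mᵀ + M`, so the gradient of the form
vanishes there; the proof perturbs `x` in the direction `S x`. -/
lemma IsDissipative.transpose_add_apply_eq_zero (h : IsDissipative M)
    {x : EuclideanSpace ℝ (Fin d)} (hx : ⟪x, Matrix.toEuclideanCLM (𝕜 := ℝ) M x⟫ = 0) :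
    Matrix.toEuclideanCLM (𝕜 := ℝ) (M.transpose + M) x = 0 := by
  set S := Matrix.toEuclideanCLM (𝕜 := ℝ) (M.transpose + M) with hS
  have hsymm : ∀ u v, ⟪u, S v⟫ = ⟪S u, v⟫ := by
    intro u v
    rw [real_inner_comm v (S u), hS, inner_toEuclideanCLM_transpose_add,
      inner_toEuclideanCLM_transpose_add, add_comm, real_inner_comm u, real_inner_comm v]
  have hxx : ⟪x, S x⟫ = 0 := by
    rw [hS, inner_toEuclideanCLM_transpose_add, real_inner_comm, hx, add_zero]
  set n := ⟪S x, S x⟫ with hn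
  set q := ⟪S x, S (S x)⟫ with hq
  have hquad : ∀ t : ℝ, 2 * t * n + t ^ 2 * q ≤ 0 := by
    intro t
    have := h (x + t • S x)
    rw [← hS, map_add, map_smul, inner_add_left, inner_add_right, inner_add_right,
      inner_smul_left, inner_smul_right, inner_smul_left, inner_smul_right, hxx,
      hsymm x (S x), ← hn, ← hq] at this
    simp only [conj_trivial] at this
    linarith
  have ha : 0 < |q| + 1 := by positivity
  -- A step small enough for the linear term to dominate the quadratic one.
  have h1 := hquad (n / (|q| + 1))
  have h2 : 2 * (n / (|q| + 1)) * n + (n / (|q| + 1)) ^ 2 * q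
      = n ^ 2 * ((2 * (|q| + 1) + q) / (|q| + 1) ^ 2) := by field_simp
  have h3 : 0 < (2 * (|q| + 1) + q) / (|q| + 1) ^ 2 :=
    div_pos (by linarith [neg_abs_le q, abs_nonneg q]) (by positivity)
  rw [h2] at h1
  have h4 : n ^ 2 = 0 := le_antisymm (by nlinarith) (sq_nonneg n)
  exact inner_self_eq_zero.1 (pow_eq_zero_iff two_ne_zero |>.1 h4)

open scoped Matrix in
/-- A Hurwitz matrix has no nonzero orbit on which `Mᵀ + M` vanishes. -/
lemma IsHurwitz.eq_zero_of_forall_pow (h : IsHurwitz M) {x : EuclideanSpace ℝ (Fin d)}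
    (hx : ∀ k : ℕ, Matrix.toEuclideanCLM (𝕜 := ℝ) (M.transpose + M)
      ((Matrix.toEuclideanCLM (𝕜 := ℝ) M ^ k) x) = 0) : x = 0 := by
  by_contra hne
  set Mc : Matrix (Fin d) (Fin d) ℂ := M.map (algebraMap ℝ ℂ) with hMc
  let cx : EuclideanSpace ℝ (Fin d) → Fin d → ℂ := fun v i => (v i : ℂ)
  have hcx : ∀ (P : Matrix (Fin d) (Fin d) ℝ) v,
      cx (Matrix.toEuclideanCLM (𝕜 := ℝ) P v) = P.map (algebraMap ℝ ℂ) *ᵥ cx v := by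
    intro P v
    ext i
    simp [cx, Matrix.mulVec, dotProduct, Matrix.ofLp_toEuclideanCLM]
  set f := Matrix.toLin' Mc with hf
  set S := Matrix.toLin' (Mc.transpose + Mc) with hS
  -- The unobservable subspace of `(S, f)`: it is `f`-invariant and contains `x`, so it contains a
  -- complex eigenvector of `M` killed by `Mᵀ + M`.
  let W : Submodule ℂ (Fin d → ℂ) := ⨅ k : ℕ, LinearMap.ker (S ∘ₗ f ^ k)
  have hWmem : ∀ v, v ∈ W ↔ ∀ k : ℕ, S ((f ^ k) v) = 0 := by
    intro v; simp [W, Submodule.mem_iInf]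
  have hfW : ∀ v ∈ W, f v ∈ W := by
    intro v hv
    rw [hWmem] at hv ⊢
    intro k
    have := hv (k + 1)
    rwa [pow_succ, Module.End.mul_apply] at this
  have hpow : ∀ k : ℕ, (f ^ k) (cx x) = cx ((Matrix.toEuclideanCLM (𝕜 := ℝ) M ^ k) x) := by
    intro k
    induction k with
    | zero => simp
    | succ k ih =>
      rw [pow_succ', Module.End.mul_apply, ih, pow_succ', mul_apply_eq_comp, hcx]
      rfl
  have hxW : cx x ∈ W := by
    rw [hWmem]
    intro k
    have hsum : Mc.transpose + Mc = (M.transpose + M).map (algebraMap ℝ ℂ) := by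
      ext i j; simp [hMc]
    rw [hpow, hS, Matrix.toLin'_apply, hsum, ← hcx, hx]
    ext i; simp [cx]
  have hcx0 : cx x ≠ 0 := by
    intro h0
    apply hne
    ext i
    have := congrFun h0 i
    simpa [cx] using this
  have : Nontrivial W := ⟨⟨⟨cx x, hxW⟩, 0, fun h0 => hcx0 (congrArg Subtype.val h0)⟩⟩
  obtain ⟨μ, hμ⟩ := Module.End.exists_eigenvalue (f.restrict hfW)
  obtain ⟨⟨v, hvW⟩, hv⟩ := hμ.exists_hasEigenvector
  have hv0 : v ≠ 0 := fun h0 => hv.2 (Subtype.ext h0)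
  have hfv : Mc *ᵥ v = μ • v := by
    exact congrArg Subtype.val hv.apply_eq_smul
  have hSv : (Mc.transpose + Mc) *ᵥ v = 0 := by
    exact (hWmem v).1 hvW 0
  have hspec : μ ∈ spectrum ℂ Mc := by
    rw [← Matrix.spectrum_toLin']
    exact (Module.End.hasEigenvalue_of_hasEigenvector
      ⟨Module.End.mem_eigenspace_iff.2 hfv, hv0⟩).mem_spectrum
  have hre := h μ hspec
  have hstar : Mc *ᵥ star v = star (Mc *ᵥ v) := by
    ext i
    simp [Matrix.mulVec, dotProduct, hMc]
  -- The left side is zero, hence `Re μ = 0`, against Hurwitz.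
  have h0 : star v ⬝ᵥ ((Mc.transpose + Mc) *ᵥ v) = (star μ + μ) * (star v ⬝ᵥ v) := by
    rw [Matrix.add_mulVec, dotProduct_add, Matrix.dotProduct_mulVec, Matrix.vecMul_transpose,
      hstar, hfv, star_smul, smul_dotProduct, dotProduct_smul, smul_eq_mul, smul_eq_mul, add_mul]
  rw [hSv, dotProduct_zero] at h0
  have h1 : star v ⬝ᵥ v ≠ 0 := by
    open scoped ComplexOrder in exact mt dotProduct_star_self_eq_zero.1 hv0
  have h2 : star μ + μ = 0 := (mul_eq_zero.1 h0.symm).resolve_right h1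
  have h3 := congrArg Complex.re h2
  simp at h3
  linarith

/-- A relaxed solution on a sphere of a pair of dissipative systems, the first of which is Hurwitz,
stays in the kernel of the second quadratic form. -/
lemma IsRelaxedSolution.inner_eq_zero {P Q : Matrix (Fin d) (Fin d) ℝ} {m r : ℝ}
    {y : ℝ → EuclideanSpace ℝ (Fin d)}
    (h : IsRelaxedSolution (Matrix.toEuclideanCLM (𝕜 := ℝ) P) (Matrix.toEuclideanCLM (𝕜 := ℝ) Q) m y)
    (hr : ∀ s, ‖y s‖ = r) (hP : IsDissipative P) (hQ : IsDissipative Q) (hH : IsHurwitz P) (s : ℝ) :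
    ⟪y s, Matrix.toEuclideanCLM (𝕜 := ℝ) Q (y s)⟫ = 0 := by
  by_contra hne
  set T₀ := Matrix.toEuclideanCLM (𝕜 := ℝ) P with hT₀
  set T₁ := Matrix.toEuclideanCLM (𝕜 := ℝ) Q with hT₁
  have hopen : ∀ᶠ t in 𝓝 s, ⟪y t, T₁ (y t)⟫ ≠ 0 := by
    have : Continuous fun t => ⟪y t, T₁ (y t)⟫ := by
      have := h.continuous
      fun_prop
    exact this.continuousAt.eventually_ne hne
  have hlocal : ∀ t, ⟪y t, T₁ (y t)⟫ ≠ 0 → ⟪y t, T₀ (y t)⟫ = 0 ∧ HasDerivAt y (T₀ (y t)) t := by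
    intro t ht
    have hd := h.hasDerivAt_inner_self hr t
    obtain ⟨l, hl, hle⟩ := h.exists_mix_eq _ hd
    have hle' := hle
    simp only [mix_apply, innerSL_apply_apply, inner_add_right, inner_smul_right] at hle'
    have h0 := hP.inner_nonpos (y t)
    have h1 := lt_of_le_of_ne (hQ.inner_nonpos (y t)) ht
    -- A vanishing convex combination of nonpositive numbers gives no weight to the negative one.
    have hl0 : l = 0 := by
      by_contra hl0
      have : 0 < l := lt_of_le_of_ne hl.1 (Ne.symm hl0)
      have := mul_neg_of_pos_of_neg this h1
      have := mul_nonpos_of_nonneg_of_nonpos (sub_nonneg.2 hl.2) h0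
      linarith
    subst hl0
    have h2 : ⟪y t, T₀ (y t)⟫ = 0 := by simpa using hle'
    refine ⟨h2, ?_⟩
    have h3 := h.hasDerivAt_of_ne _ hd
      (by simpa only [innerSL_apply_apply, h2] using fun e => ht e.symm) hle
    simpa [mix_apply] using h3
  -- Each step differentiates the previous identity along `y' = T₀ y`, hence the need for a
  -- neighbourhood of `s`.
  have hall : ∀ k : ℕ, ∀ᶠ t in 𝓝 s,
      Matrix.toEuclideanCLM (𝕜 := ℝ) (P.transpose + P) ((T₀ ^ k) (y t)) = 0 := by
    intro k
    induction k with
    | zero =>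
      filter_upwards [hopen] with t ht
      exact hP.transpose_add_apply_eq_zero (hlocal t ht).1
    | succ k ih =>
      filter_upwards [hopen, ih.eventually_nhds] with t ht ht'
      have e1 := ((Matrix.toEuclideanCLM (𝕜 := ℝ) (P.transpose + P)).comp
        (T₀ ^ k)).hasFDerivAt.comp_hasDerivAt t (hlocal t ht).2
      have e2 := (hasDerivAt_const t (0 : EuclideanSpace ℝ (Fin d))).congr_of_eventuallyEq
        (f₁ := fun t => Matrix.toEuclideanCLM (𝕜 := ℝ) (P.transpose + P) ((T₀ ^ k) (y t))) ht'
      rw [pow_succ, mul_apply_eq_comp]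
      exact e1.unique e2
  have hy0 : y s = 0 := hH.eq_zero_of_forall_pow fun k => (hall k).self_of_nhds
  exact hne (by simp [hy0])

end Dissipative

/-! ### Bilinearity of the exterior product -/

section Wedge

variable {W : Type*} [AddCommGroup W] [Module ℝ W]

lemma wedge_self (v : W) : wedge v v = 0 :=
  (exteriorPower.ιMulti ℝ 2).map_eq_zero_of_eq ![v, v] (i := 0) (j := 1) rfl (by decide)

lemma wedge_swap (v w : W) : wedge v w = -wedge w v := by
  have := (exteriorPower.ιMulti ℝ 2).map_swap ![w, v] (i := 0) (j := 1) (by decide)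
  rw [wedge, wedge, ← this]
  congr 1
  ext i
  fin_cases i <;> rfl

lemma wedge_add_left (u v w : W) : wedge (u + v) w = wedge u w + wedge v w :=
  (exteriorPower.ιMulti ℝ 2).map_vecCons_add ![w] u v

lemma wedge_smul_left (a : ℝ) (v w : W) : wedge (a • v) w = a • wedge v w :=
  (exteriorPower.ιMulti ℝ 2).map_vecCons_smul ![w] a v

lemma wedge_add_right (u v w : W) : wedge u (v + w) = wedge u v + wedge u w := by
  rw [wedge_swap, wedge_add_left, wedge_swap v, wedge_swap w]
  abel

lemma wedge_smul_right (a : ℝ) (v w : W) : wedge v (a • w) = a • wedge v w := by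
  rw [wedge_swap, wedge_smul_left, wedge_swap w, smul_neg, neg_neg]

lemma wedge_zero_left (w : W) : wedge 0 w = 0 := by
  simpa using wedge_smul_left 0 (0 : W) w

lemma wedge_zero_right (w : W) : wedge w 0 = 0 := by
  rw [wedge_swap, wedge_zero_left, neg_zero]

end Wedge

/-! ### Consequences of observability -/

section Observable

variable {V W : Type*} [NormedAddCommGroup V] [NormedSpace ℝ V] [NormedAddCommGroup W]
  [NormedSpace ℝ W] {C : V →L[ℝ] W} {A : V →L[ℝ] V}

lemma exp_apply_of_apply_eq_zero [CompleteSpace V] {A : V →L[ℝ] V} {x : V} (hx : A x = 0) :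
    NormedSpace.exp A x = x := by
  have h1 := NormedSpace.exp_series_hasSum_exp' (𝕂 := ℝ) A
  have h2 := (ContinuousLinearMap.apply ℝ V x).hasSum h1
  have h3 : HasSum (fun n : ℕ => ((n.factorial⁻¹ : ℝ) • A ^ n) x) x := by
    have := hasSum_single (f := fun n : ℕ => ((n.factorial⁻¹ : ℝ) • A ^ n) x) 0 fun n hn => by
      obtain ⟨k, rfl⟩ := Nat.exists_eq_succ_of_ne_zero hn
      simp [pow_succ, hx]
    simpa using this
  exact h2.unique h3

lemma IsObservablePair.eq_zero [CompleteSpace V] (h : IsObservablePair C A) {x : V}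
    (hC : C x = 0) (hA : A x = 0) : x = 0 := by
  by_contra hx
  obtain ⟨t, -, ht⟩ := h x 0 hx
  rw [exp_apply_of_apply_eq_zero (by simp [hA]), map_zero, map_zero, hC] at ht
  exact ht rfl

lemma IsObservablePair.exists_ne_zero (h : IsObservablePair C A) {x : V} (hx : x ≠ 0) :
    ∃ v, C v ≠ 0 := by
  by_contra! hC
  obtain ⟨t, -, ht⟩ := h x 0 hx
  exact ht (by rw [hC, hC])

end Observable

/-! ### The blocks of the system along `K`, and limit curves -/

section Blocks

variable {d : ℕ} (B : Fin 2 → Matrix (Fin d) (Fin d) ℝ)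

lemma toEuclideanCLM_convexMatrix (l : ℝ) :
    Matrix.toEuclideanCLM (𝕜 := ℝ) (convexMatrix B l)
      = mix (Matrix.toEuclideanCLM (𝕜 := ℝ) (B 0)) (Matrix.toEuclideanCLM (𝕜 := ℝ) (B 1)) l := by
  rw [convexMatrix, map_add, map_smul, map_smul, mix]

lemma A_eq (l : ℝ) (x : K B) : A B l x = (K B).orthogonalProjectionOnto
    (mix (Matrix.toEuclideanCLM (𝕜 := ℝ) (B 0)) (Matrix.toEuclideanCLM (𝕜 := ℝ) (B 1)) l x) := by
  rw [← toEuclideanCLM_convexMatrix]; rfl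

lemma C_eq (l : ℝ) (x : K B) : C B l x = (K B)ᗮ.orthogonalProjectionOnto
    (mix (Matrix.toEuclideanCLM (𝕜 := ℝ) (B 0)) (Matrix.toEuclideanCLM (𝕜 := ℝ) (B 1)) l x) := by
  rw [← toEuclideanCLM_convexMatrix]; rfl

lemma C_zero_eq (x : K B) : C B 0 x = (K B)ᗮ.orthogonalProjectionOnto
    (Matrix.toEuclideanCLM (𝕜 := ℝ) (B 0) x) := by
  rw [C_eq, mix_apply]; simp

lemma C_one_eq (x : K B) : C B 1 x = (K B)ᗮ.orthogonalProjectionOnto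
    (Matrix.toEuclideanCLM (𝕜 := ℝ) (B 1) x) := by
  rw [C_eq, mix_apply]; simp

lemma C_apply (l : ℝ) (x : K B) : C B l x = (1 - l) • C B 0 x + l • C B 1 x := by
  rw [C_eq, C_zero_eq, C_one_eq, mix_apply, map_add, map_smul, map_smul]

lemma A_apply (l : ℝ) (x : K B) : A B l x = (1 - l) • A B 0 x + l • A B 1 x := by
  rw [A_eq, A_eq, A_eq, mix_apply, mix_apply, mix_apply]
  simp

lemma mem_K_iff {x : EuclideanSpace ℝ (Fin d)} : x ∈ K B ↔
    Matrix.toEuclideanCLM (𝕜 := ℝ) ((B 0).transpose + B 0) x = 0 ∧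
    Matrix.toEuclideanCLM (𝕜 := ℝ) ((B 1).transpose + B 1) x = 0 := Iff.rfl

/-- Both quadratic forms vanish on `K`. -/
lemma inner_A_self (l : ℝ) (x : K B) : ⟪x, A B l x⟫ = 0 := by
  have hi : ∀ M : Matrix (Fin d) (Fin d) ℝ,
      Matrix.toEuclideanCLM (𝕜 := ℝ) (M.transpose + M) (x : EuclideanSpace ℝ (Fin d)) = 0 →
      ⟪(x : EuclideanSpace ℝ (Fin d)), Matrix.toEuclideanCLM (𝕜 := ℝ) M x⟫ = 0 := by
    intro M hM
    have := inner_toEuclideanCLM_transpose_add M x x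
    rw [hM, inner_zero_right, real_inner_comm] at this
    linarith
  have hx := (mem_K_iff B).1 x.2
  rw [A_eq, Submodule.inner_orthogonalProjectionOnto_eq_of_mem_left, mix_apply, inner_add_right,
    inner_smul_right, inner_smul_right, hi _ hx.1, hi _ hx.2]
  simp

variable {B}

lemma C_zero_eq_smul {l : ℝ} {x : K B} (h : C B l x = 0) :
    C B 0 x = l • (C B 0 x - C B 1 x) := by
  rw [C_apply] at h
  have : C B 0 x - l • (C B 0 x - C B 1 x) = 0 := by rw [← h]; module
  exact sub_eq_zero.1 this

lemma mem_N_of_eq {l : ℝ} {x : K B} (h : C B l x = 0) (he : C B 0 x = C B 1 x) : x ∈ N B := by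
  have h0 : C B 0 x = 0 := by rw [C_zero_eq_smul h, he, sub_self, smul_zero]
  exact ⟨h0, he ▸ h0⟩

lemma C_eq_zero_of_mem_N {x : K B} (hx : x ∈ N B) (l : ℝ) : C B l x = 0 := by
  rw [C_apply, hx.1, hx.2, smul_zero, smul_zero, add_zero]

lemma lam_eq {l : ℝ} {x : K B} (h : C B l x = 0) (hne : C B 0 x ≠ C B 1 x) : lam B x = l := by
  have hp : ‖C B 0 x - C B 1 x‖ ^ 2 ≠ 0 := by
    have := norm_pos_iff.2 (sub_ne_zero.2 hne)
    positivity
  rw [lam]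
  nth_rewrite 2 [C_zero_eq_smul h]
  rw [inner_smul_right, real_inner_self_eq_norm_sq, mul_div_cancel_right₀ _ hp]

/-- A relaxed solution that stays in `K`: it moves in `F`, with velocity `A_l z` where `C_l z = 0`
determines `l`. -/
structure IsLimitCurve (B : Fin 2 → Matrix (Fin d) (Fin d) ℝ) (z : ℝ → K B) : Prop where
  continuous : Continuous z
  mem_sphere : ∀ s, z s ∈ Metric.sphere (0 : K B) 1
  mem_F : ∀ s, z s ∈ F B
  hasDerivAt : ∀ s l, C B l (z s) = 0 → C B 0 (z s) ≠ C B 1 (z s) →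
    HasDerivAt z (A B l (z s)) s
  not_const : (∀ l ∈ Icc (0 : ℝ) 1, ∀ x, C B l x = 0 → A B l x = 0 → x = 0) →
    ∃ s, z s ≠ z 0

/-- A switched system of dissipative Hurwitz matrices that is not GUAS has a limit curve. -/
theorem exists_isLimitCurve (hH : ∀ i, IsHurwitz (B i)) (hL : ∀ i, IsDissipative (B i))
    (hB : ¬ IsGUAS B) : ∃ z, IsLimitCurve B z := by
  simp only [IsGUAS, not_forall] at hB
  obtain ⟨u, hu, x, hx, hlim⟩ := hB
  set T₀ := Matrix.toEuclideanCLM (𝕜 := ℝ) (B 0) with hT₀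
  set T₁ := Matrix.toEuclideanCLM (𝕜 := ℝ) (B 1) with hT₁
  have hdriven : IsDriven T₀ T₁ (fun t => ((u t : ℕ) : ℝ)) x := by
    refine ⟨?_, fun s => ?_, hx.1, fun t ht => ?_⟩
    · exact (measurable_from_top (f := fun i : Fin 2 => ((i : ℕ) : ℝ))).comp hu
    · have : ((u s : ℕ) : ℝ) ≤ 1 := by exact_mod_cast Nat.le_of_lt_succ (u s).2
      exact ⟨Nat.cast_nonneg _, this⟩
    · rw [hx.2 t ht]
      have : ∀ s, mix T₀ T₁ ((u s : ℕ) : ℝ) (x s)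
          = Matrix.toEuclideanCLM (𝕜 := ℝ) (B (u s)) (x s) := by
        intro s
        rw [mix_apply]
        generalize u s = i
        fin_cases i <;> simp [hT₀, hT₁]
      simp only [this]
  obtain ⟨y, r, M, hr0, hr, hy⟩ := hdriven.exists_relaxedSolution
    (fun v => (hL 0).inner_nonpos v) (fun v => (hL 1).inner_nonpos v) hlim
  replace hy := hy.smul r⁻¹
  replace hr : ∀ s, ‖r⁻¹ • y s‖ = 1 := fun s => by
    rw [norm_smul, hr, Real.norm_of_nonneg (by positivity), inv_mul_cancel₀ hr0.ne']
  generalize |r⁻¹| * M = M' at hy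
  set y' : ℝ → EuclideanSpace ℝ (Fin d) := fun s => r⁻¹ • y s with hy'
  -- Each form is handled using that the other matrix is Hurwitz, hence the swap.
  have hK : ∀ s, y' s ∈ K B := fun s =>
    ⟨(hL 0).transpose_add_apply_eq_zero (hy.swap.inner_eq_zero hr (hL 1) (hL 0) (hH 1) s),
      (hL 1).transpose_add_apply_eq_zero (hy.inner_eq_zero hr (hL 0) (hL 1) (hH 0) s)⟩
  have hd : ∀ s, HasDerivAt (fun t => (K B)ᗮ.orthogonalProjectionOnto (y' t)) 0 s := by
    intro s
    have : ∀ t, (K B)ᗮ.orthogonalProjectionOnto (y' t) = 0 := fun t =>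
      Submodule.orthogonalProjectionOnto_orthogonal_apply_eq_zero (hK t)
    simp only [this]
    exact hasDerivAt_const _ _
  refine ⟨fun s => ⟨y' s, hK s⟩, hy.continuous.subtype_mk _, fun s => ?_, fun s => ?_,
    fun s l hl hne => ?_, fun hobs => ?_⟩
  · simpa using hr s
  · obtain ⟨l, hl, hle⟩ := hy.exists_mix_eq _ (hd s)
    exact ⟨l, hl, by rw [C_eq]; exact hle⟩
  · rw [C_eq] at hl
    rw [C_zero_eq, C_one_eq] at hne
    have h1 := hy.hasDerivAt_of_ne _ (hd s) hne hl
    have h2 := (K B).orthogonalProjectionOnto.hasFDerivAt.comp_hasDerivAt s h1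
    rw [A_eq]
    refine h2.congr_of_eventuallyEq (Eventually.of_forall fun t => ?_)
    exact (Submodule.orthogonalProjectionOnto_mem_subspace_eq_self (K := K B) ⟨y' t, hK t⟩).symm
  -- A constant curve has velocity zero, so a unit vector of `K` would be killed by some `B_l`.
  · by_contra! hconst
    have hc : ∀ s, y' s = y' 0 := fun s => congrArg Subtype.val (hconst s)
    have hd' : HasDerivAt (fun t => ContinuousLinearMap.id ℝ _ (y' t)) 0 0 := by
      simp only [hc, ContinuousLinearMap.id_apply]
      exact hasDerivAt_const _ _
    obtain ⟨l, hl, hle⟩ := hy.exists_mix_eq _ hd'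
    rw [ContinuousLinearMap.id_apply] at hle
    have h0 := hobs l hl ⟨y' 0, hK 0⟩ (by rw [C_eq, hle, map_zero]) (by rw [A_eq, hle, map_zero])
    have h1 := hr 0
    have h2 : y' 0 = 0 := congrArg Subtype.val h0
    rw [show r⁻¹ • y 0 = y' 0 from rfl, h2, norm_zero] at h1
    exact zero_ne_one h1

end Blocks

/-! ### Limit curves lie in `G`; the discrete case -/

section LimitCurve

variable {d : ℕ} {B : Fin 2 → Matrix (Fin d) (Fin d) ℝ} {z : ℝ → K B}

lemma tangency_eq_zero_of_mem_N {x : K B} (hx : x ∈ N B) (l : ℝ) : tangency B l x = 0 := by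
  rw [tangency, hx.1, hx.2, wedge_zero_left, wedge_zero_right, add_zero]

/-- `C_0 a ∧ C_1 x + C_0 x ∧ C_1 a` vanishes if `C_l x = 0` and `C_l a` is parallel to
`C_0 x - C_1 x`. -/
lemma tangency_eq_zero_of_parallel {l m : ℝ} {x : K B} (hx : C B l x = 0)
    (ha : C B 0 (A B l x) - l • (C B 0 (A B l x) - C B 1 (A B l x)) = m • (C B 0 x - C B 1 x)) :
    tangency B l x = 0 := by
  have h0 := C_zero_eq_smul hx
  set e := C B 0 x - C B 1 x with he
  set f := C B 0 (A B l x) - C B 1 (A B l x) with hf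
  have h1 : C B 1 x = (l - 1) • e := by
    rw [sub_smul, one_smul, ← h0, he, sub_sub_cancel]
  have ha0 : C B 0 (A B l x) = l • f + m • e := sub_eq_iff_eq_add'.1 ha
  have ha1 : C B 1 (A B l x) = (l - 1) • f + m • e := by
    have : C B 1 (A B l x) = C B 0 (A B l x) - f := by rw [hf, sub_sub_cancel]
    rw [this, ha0]; module
  rw [tangency, h0, h1, ha0, ha1]
  simp only [wedge_add_left, wedge_add_right, wedge_smul_left, wedge_smul_right, wedge_self,
    smul_zero, add_zero]
  rw [wedge_swap e f]
  module

namespace IsLimitCurve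

lemma tangency_lam_eq_zero (hz : IsLimitCurve B z) {s : ℝ} (hs : z s ∈ F₀ B) :
    tangency B (lam B (z s)) (z s) = 0 := by
  have hne : C B 0 (z s) ≠ C B 1 (z s) := by
    obtain ⟨⟨l, -, hl⟩, hN⟩ := hs
    exact fun h => hN (mem_N_of_eq hl h)
  have hC : ∀ t, C B 0 (z t) ≠ C B 1 (z t) → C B (lam B (z t)) (z t) = 0 := by
    intro t ht
    obtain ⟨l, -, hl⟩ := hz.mem_F t
    rwa [lam_eq hl ht]
  have hopen : ∀ᶠ t in 𝓝 s, C B 0 (z t) ≠ C B 1 (z t) := by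
    have hcont := hz.continuous
    have h1 : ContinuousAt (fun t => C B 0 (z t)) s := by fun_prop
    have h2 : ContinuousAt (fun t => C B 1 (z t)) s := by fun_prop
    filter_upwards [(h1.sub h2).eventually_ne (sub_ne_zero.2 hne)] with t ht
    exact sub_ne_zero.1 ht
  have hzd := hz.hasDerivAt s _ (hC s hne) hne
  have hd0 := (C B 0).hasFDerivAt.comp_hasDerivAt s hzd
  have hd1 := (C B 1).hasFDerivAt.comp_hasDerivAt s hzd
  have hlam : DifferentiableAt ℝ (fun t => lam B (z t)) s := by
    have e0 : DifferentiableAt ℝ (fun t => C B 0 (z t)) s := hd0.differentiableAt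
    have e1 : DifferentiableAt ℝ (fun t => C B 1 (z t)) s := hd1.differentiableAt
    refine ((e0.sub e1).inner ℝ e0).div ((e0.sub e1).norm_sq ℝ) ?_
    have := norm_pos_iff.2 (sub_ne_zero.2 hne)
    positivity
  -- The derivative of `C₀ z = λ (C₀ z - C₁ z)`: the term in `λ'` is parallel to `C₀ z - C₁ z`, and
  -- the wedge eliminates it.
  have hprod := hd0.sub (hlam.hasDerivAt.smul (hd0.sub hd1))
  have hzero : HasDerivAt (fun t => C B 0 (z t) - lam B (z t) • (C B 0 (z t) - C B 1 (z t)))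
      0 s := by
    refine (hasDerivAt_const s (0 : (K B)ᗮ)).congr_of_eventuallyEq ?_
    filter_upwards [hopen] with t ht
    rw [← C_zero_eq_smul (hC t ht), sub_self]
  have h := hprod.unique hzero
  refine tangency_eq_zero_of_parallel (m := deriv (fun t => lam B (z t)) s) (hC s hne) ?_
  simp only [Function.comp_apply, Pi.sub_apply] at h
  rw [← sub_sub, sub_eq_zero] at h
  exact h

lemma mem_G (hz : IsLimitCurve B z) (s : ℝ) : z s ∈ G B := by
  refine ⟨⟨hz.mem_sphere s, hz.mem_F s⟩, ?_⟩
  by_cases hN : z s ∈ N B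
  · exact Or.inl ⟨hN, 0, by simp, tangency_eq_zero_of_mem_N hN 0⟩
  · exact Or.inr ⟨⟨hz.mem_F s, hN⟩, hz.tangency_lam_eq_zero ⟨hz.mem_F s, hN⟩⟩

end IsLimitCurve

variable (B) in
/-- Observability of all the pairs `(C_l, A_l)`. -/
def IsUniformlyObservable : Prop := ∀ l ∈ Icc (0 : ℝ) 1, IsObservablePair (C B l) (A B l)

lemma IsUniformlyObservable.A_ne_zero (hobs : IsUniformlyObservable B) {l : ℝ}
    (hl : l ∈ Icc (0 : ℝ) 1) {x : K B} (hx : x ≠ 0) (hC : C B l x = 0) : A B l x ≠ 0 :=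
  fun hA => hx ((hobs l hl).eq_zero hC hA)

lemma IsLimitCurve.false_of_isDiscrete (hz : IsLimitCurve B z) (hobs : IsUniformlyObservable B)
    (hG : IsDiscrete (G B)) : False := by
  obtain ⟨s, hs⟩ := hz.not_const fun l hl x hC hA => (hobs l hl).eq_zero hC hA
  have := hG.to_subtype
  have hc : Continuous fun t => (⟨z t, hz.mem_G t⟩ : G B) := hz.continuous.subtype_mk _
  -- A continuous map from the line to a discrete space is constant.
  exact hs (congrArg Subtype.val
    (PreconnectedSpace.constant (inferInstance : PreconnectedSpace ℝ) hc (x := s) (y := 0)))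

/-! ### The case `dim K ≤ 2` -/

lemma exists_eq_smul_add_smul {V : Type*} [NormedAddCommGroup V] [InnerProductSpace ℝ V]
    [FiniteDimensional ℝ V] (hV : Module.finrank ℝ V ≤ 2) {v w : V} (hv : v ≠ 0) (hw : w ≠ 0)
    (hvw : ⟪v, w⟫ = 0) (x : V) : ∃ a b : ℝ, x = a • v + b • w := by
  have hv' : ⟪v, v⟫ ≠ 0 := inner_self_ne_zero.2 hv
  have hw' : ⟪w, w⟫ ≠ 0 := inner_self_ne_zero.2 hw
  have hwv : ⟪w, v⟫ = 0 := by rw [real_inner_comm, hvw]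
  refine ⟨⟪v, x⟫ / ⟪v, v⟫, ⟪w, x⟫ / ⟪w, w⟫, ?_⟩
  set p := x - ((⟪v, x⟫ / ⟪v, v⟫) • v + (⟪w, x⟫ / ⟪w, w⟫) • w) with hp
  suffices p = 0 from sub_eq_zero.1 this
  by_contra hp0
  have hvp : ⟪v, p⟫ = 0 := by
    rw [hp, inner_sub_right, inner_add_right, inner_smul_right, inner_smul_right, hvw]
    field_simp; simp
  have hwp : ⟪w, p⟫ = 0 := by
    rw [hp, inner_sub_right, inner_add_right, inner_smul_right, inner_smul_right, hwv]
    field_simp; simp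
  have hlin : LinearIndependent ℝ ![v, w, p] := by
    refine linearIndependent_of_ne_zero_of_inner_eq_zero (𝕜 := ℝ) ?_ ?_
    · intro i; fin_cases i <;> assumption
    · intro i j hij
      fin_cases i <;> fin_cases j <;> first
        | exact absurd rfl hij
        | assumption
        | (rw [real_inner_comm]; assumption)
  have := hlin.fintype_card_le_finrank
  rw [Fintype.card_fin] at this
  omega

lemma exists_eq_smul_of_inner_eq_zero {V : Type*} [NormedAddCommGroup V] [InnerProductSpace ℝ V]
    [FiniteDimensional ℝ V] (hV : Module.finrank ℝ V ≤ 2) {v w : V} (hv : v ≠ 0) (hw : w ≠ 0)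
    (hvw : ⟪v, w⟫ = 0) {x : V} (hx : ⟪x, w⟫ = 0) : ∃ a : ℝ, x = a • v := by
  obtain ⟨a, b, rfl⟩ := exists_eq_smul_add_smul hV hv hw hvw x
  rw [inner_add_left, inner_smul_left, inner_smul_left, hvw, mul_zero, zero_add] at hx
  have hb : b = 0 := (mul_eq_zero.1 hx).resolve_right (inner_self_ne_zero.2 hw)
  exact ⟨a, by rw [hb, zero_smul, add_zero]⟩

lemma eq_zero_of_smul_add_smul_eq_zero {V : Type*} [NormedAddCommGroup V] [InnerProductSpace ℝ V]
    {v w : V} (hv : v ≠ 0) (hw : w ≠ 0) (hvw : ⟪v, w⟫ = 0) {a b : ℝ} (h : a • v + b • w = 0) :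
    a = 0 ∧ b = 0 := by
  have h1 := congrArg (inner ℝ v) h
  have h2 := congrArg (inner ℝ w) h
  rw [inner_add_right, inner_smul_right, inner_smul_right, inner_zero_right] at h1 h2
  rw [hvw, mul_zero, add_zero] at h1
  rw [real_inner_comm, hvw, mul_zero, zero_add] at h2
  exact ⟨(mul_eq_zero.1 h1).resolve_right (inner_self_ne_zero.2 hv),
    (mul_eq_zero.1 h2).resolve_right (inner_self_ne_zero.2 hw)⟩

/-- Every `C_l` kills `v`, and `v`, `A_l v` span `K`. Since `C_l` is not zero, its kernel is the
line through `v`, so `G` has at most two points. -/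
lemma isDiscrete_G_of_mem_N (hobs : IsUniformlyObservable B)
    (hK : Module.finrank ℝ (K B) ≤ 2) {v : K B} (hvN : v ∈ N B) (hv : v ≠ 0) :
    IsDiscrete (G B) := by
  refine Set.Finite.isDiscrete ((Set.toFinite {‖v‖⁻¹ • v, -(‖v‖⁻¹ • v)}).subset ?_)
  rintro x ⟨⟨hx1, l, hl, hlx⟩, -⟩
  have hCv := C_eq_zero_of_mem_N hvN l
  have hAv := hobs.A_ne_zero hl hv hCv
  obtain ⟨a, b, rfl⟩ := exists_eq_smul_add_smul hK hv hAv (inner_A_self B l v) x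
  rw [map_add, map_smul, map_smul, hCv, smul_zero, zero_add] at hlx
  rcases smul_eq_zero.1 hlx with hb | hb
  · subst hb
    rw [zero_smul, add_zero, mem_sphere_zero_iff_norm, norm_smul] at hx1
    have ha : ‖a‖ = ‖v‖⁻¹ := eq_inv_of_mul_eq_one_left hx1
    rw [zero_smul, add_zero, mem_insert_iff, mem_singleton_iff, ← neg_smul, ← ha]
    rcases abs_choice a with h | h
    · left; rw [Real.norm_eq_abs, h]
    · right; rw [Real.norm_eq_abs, h, neg_neg]
  · obtain ⟨w, hw⟩ := (hobs l hl).exists_ne_zero hv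
    obtain ⟨a', b', rfl⟩ := exists_eq_smul_add_smul hK hv hAv (inner_A_self B l v) w
    exact absurd (by rw [map_add, map_smul, map_smul, hCv, hb, smul_zero, smul_zero, add_zero]) hw

/-- If `F` were all of `K`, every `x` would satisfy `C₀ x = λ D x` with `D = C₀ - C₁` injective. As
for an operator having every vector as an eigenvector, `λ` would be the same on a basis, making some
`C_l` zero, against observability. -/
lemma exists_notMem_F (hobs : IsUniformlyObservable B) (hK : Module.finrank ℝ (K B) ≤ 2)
    (hN : ∀ x ∈ N B, x = 0) {v : K B} (hv : v ≠ 0) : ∃ w, w ∉ F B := by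
  by_contra! hF
  have hinj : ∀ x, C B 0 x - C B 1 x = 0 → x = 0 := by
    intro x hx
    obtain ⟨l, -, hl⟩ := hF x
    exact hN x (mem_N_of_eq hl (sub_eq_zero.1 hx))
  obtain ⟨l, hl, hlv⟩ := hF v
  have hAv := hobs.A_ne_zero hl hv hlv
  set w := A B l v with hw
  have hvw : ⟪v, w⟫ = 0 := inner_A_self B l v
  obtain ⟨m, -, hmw⟩ := hF w
  obtain ⟨k, -, hk⟩ := hF (v + w)
  have e1 := C_zero_eq_smul hlv
  have e2 := C_zero_eq_smul hmw
  have e3 := C_zero_eq_smul hk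
  have h0 : (k - l) • v + (k - m) • w = 0 := by
    apply hinj
    rw [map_add, map_add] at e3
    simp only [map_add, map_smul]
    have : C B 0 v + C B 0 w - k • (C B 0 v + C B 0 w - (C B 1 v + C B 1 w)) = 0 :=
      sub_eq_zero.2 e3
    calc (k - l) • C B 0 v + (k - m) • C B 0 w - ((k - l) • C B 1 v + (k - m) • C B 1 w)
        = (C B 0 v - l • (C B 0 v - C B 1 v)) + (C B 0 w - m • (C B 0 w - C B 1 w))
          - (C B 0 v + C B 0 w - k • (C B 0 v + C B 0 w - (C B 1 v + C B 1 w))) := by module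
      _ = 0 := by rw [this, sub_eq_zero.2 e1, sub_eq_zero.2 e2]; simp
  obtain ⟨hkl, hkm⟩ := eq_zero_of_smul_add_smul_eq_zero hv hAv hvw h0
  obtain ⟨x, hx⟩ := (hobs l hl).exists_ne_zero hv
  obtain ⟨a, b, rfl⟩ := exists_eq_smul_add_smul hK hv hAv hvw x
  rw [← sub_eq_zero.1 hkm, sub_eq_zero.1 hkl] at hmw
  exact hx (by rw [map_add, map_smul, map_smul, hlv, hmw, smul_zero, smul_zero, add_zero])

lemma exists_pos_le_abs_of_forall_ne_zero {V W : Type*} [NormedAddCommGroup V] [ProperSpace V]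
    [NormedAddCommGroup W] {f : ℝ × V → ℝ} {g : ℝ × V → W} (hf : Continuous f) (hg : Continuous g)
    (hne : ∀ l ∈ Icc (0 : ℝ) 1, ∀ x ∈ Metric.sphere (0 : V) 1, g (l, x) = 0 → f (l, x) ≠ 0) :
    ∃ c > 0, ∀ l ∈ Icc (0 : ℝ) 1, ∀ x ∈ Metric.sphere (0 : V) 1, g (l, x) = 0 →
      c ≤ |f (l, x)| := by
  let P : Set (ℝ × V) := (Icc (0 : ℝ) 1 ×ˢ Metric.sphere (0 : V) 1) ∩ {p | g p = 0}
  have hP : IsCompact P :=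
    (isCompact_Icc.prod (isCompact_sphere 0 1)).inter_right (isClosed_eq hg continuous_const)
  rcases P.eq_empty_or_nonempty with hempty | hnonempty
  · exact ⟨1, one_pos, fun l hl x hx hlx =>
      absurd (show (l, x) ∈ P from ⟨⟨hl, hx⟩, hlx⟩) (hempty ▸ notMem_empty _)⟩
  · obtain ⟨p, hp, hmin⟩ := hP.exists_isMinOn hnonempty hf.abs.continuousOn
    exact ⟨|f p|, abs_pos.2 (hne p.1 hp.1.1 p.2 hp.1.2 hp.2), fun l hl x hx hlx =>
      hmin (show (l, x) ∈ P from ⟨⟨hl, hx⟩, hlx⟩)⟩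

lemma continuous_C_apply : Continuous fun p : ℝ × K B => C B p.1 p.2 := by
  have h : (fun p : ℝ × K B => C B p.1 p.2)
      = fun p => (1 - p.1) • C B 0 p.2 + p.1 • C B 1 p.2 := funext fun p => C_apply B p.1 p.2
  rw [h]
  fun_prop

lemma continuous_A_apply : Continuous fun p : ℝ × K B => A B p.1 p.2 := by
  have h : (fun p : ℝ × K B => A B p.1 p.2)
      = fun p => (1 - p.1) • A B 0 p.2 + p.1 • A B 1 p.2 := funext fun p => A_apply B p.1 p.2
  rw [h]
  fun_prop

/-- In dimension at most two, the velocities of the points of `F` on the unit sphere are uniformly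
transversal to every vector outside `F`. -/
lemma exists_le_abs_inner_A (hobs : IsUniformlyObservable B)
    (hK : Module.finrank ℝ (K B) ≤ 2) {w : K B} (hw : w ∉ F B) :
    ∃ c > 0, ∀ l ∈ Icc (0 : ℝ) 1, ∀ x ∈ Metric.sphere (0 : K B) 1, C B l x = 0 →
      c ≤ |⟪w, A B l x⟫| := by
  refine exists_pos_le_abs_of_forall_ne_zero (f := fun p : ℝ × K B => ⟪w, A B p.1 p.2⟫)
    (continuous_const.inner continuous_A_apply) continuous_C_apply fun l hl x hx hlx h0 => hw ?_
  have hx0 : x ≠ 0 := ne_zero_of_mem_unit_sphere ⟨x, hx⟩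
  have hA := hobs.A_ne_zero hl hx0 hlx
  -- In a plane, `w` and `x` both orthogonal to `A_l x ≠ 0` are parallel, so `w` would lie in the
  -- cone `F`.
  obtain ⟨a, rfl⟩ := exists_eq_smul_of_inner_eq_zero hK hx0 hA (inner_A_self B l x) h0
  exact ⟨l, hl, by rw [map_smul, hlx, smul_zero]⟩

lemma IsLimitCurve.false_of_finrank_le_two (hz : IsLimitCurve B z)
    (hobs : IsUniformlyObservable B) (hK : Module.finrank ℝ (K B) ≤ 2) : False := by
  by_cases hN : ∃ v ∈ N B, v ≠ 0
  · obtain ⟨v, hvN, hv⟩ := hN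
    exact hz.false_of_isDiscrete hobs (isDiscrete_G_of_mem_N hobs hK hvN hv)
  push Not at hN
  have hz0 : ∀ s, z s ≠ 0 := fun s => ne_zero_of_mem_unit_sphere ⟨z s, hz.mem_sphere s⟩
  obtain ⟨w, hw⟩ := exists_notMem_F hobs hK hN (hz0 0)
  obtain ⟨c, hpos, hc⟩ := exists_le_abs_inner_A hobs hK hw
  choose l hl hlz using hz.mem_F
  have hder : ∀ s, HasDerivAt (fun t => ⟪w, z t⟫) ⟪w, A B (l s) (z s)⟫ s := by
    intro s
    have hne : C B 0 (z s) ≠ C B 1 (z s) := fun h => hz0 s (hN _ (mem_N_of_eq (hlz s) h))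
    exact (innerSL ℝ w).hasFDerivAt.comp_hasDerivAt s (hz.hasDerivAt s _ (hlz s) hne)
  -- Long enough that a slope of size at least `c` exceeds the possible variation `2 * ‖w‖` of `⟪w,
  -- z⟫`.
  set T := (2 * ‖w‖ + 1) / c with hT
  have hT0 : 0 < T := by positivity
  obtain ⟨ξ, -, hξ⟩ := exists_hasDerivAt_eq_slope (fun t => ⟪w, z t⟫) _ hT0
    (fun t _ => (hder t).continuousAt.continuousWithinAt) fun t _ => hder t
  have hbd : ∀ t, |⟪w, z t⟫| ≤ ‖w‖ := by
    intro t
    have := abs_real_inner_le_norm w (z t)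
    rwa [mem_sphere_zero_iff_norm.1 (hz.mem_sphere t), mul_one] at this
  have hcξ : c ≤ |⟪w, A B (l ξ) (z ξ)⟫| := hc _ (hl ξ) _ (hz.mem_sphere ξ) (hlz ξ)
  rw [hξ, sub_zero, abs_div, abs_of_pos hT0, le_div_iff₀ hT0, hT, mul_div_cancel₀ _ hpos.ne'] at hcξ
  have h1 := abs_sub ⟪w, z T⟫ ⟪w, z 0⟫
  linarith [hbd T, hbd 0]

end LimitCurve

end SwitchedSystem

theorem theorem3 {d : ℕ} (B : Fin 2 → Matrix (Fin d) (Fin d) ℝ)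
    (hHurwitz : ∀ i, SwitchedSystem.IsHurwitz (B i))
    (hLyapunov : ∀ i, SwitchedSystem.IsDissipative (B i)) :
    ((∀ l ∈ Set.Icc (0 : ℝ) 1,
        SwitchedSystem.IsObservablePair (SwitchedSystem.C B l) (SwitchedSystem.A B l)) →
      (IsDiscrete (SwitchedSystem.G B) ∨ Module.finrank ℝ (SwitchedSystem.K B) ≤ 2) →
      SwitchedSystem.IsGUAS B) ∧
    ((∀ l ∈ Set.Icc (0 : ℝ) 1, (SwitchedSystem.C B l).ker = ⊥) →
      SwitchedSystem.IsGUAS B) := by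
  refine ⟨fun hobs h => ?_, fun hker => ?_⟩
  · by_contra hB
    obtain ⟨z, hz⟩ := SwitchedSystem.exists_isLimitCurve hHurwitz hLyapunov hB
    rcases h with hG | hK
    · exact hz.false_of_isDiscrete hobs hG
    · exact hz.false_of_finrank_le_two hobs hK
  · by_contra hB
    obtain ⟨z, hz⟩ := SwitchedSystem.exists_isLimitCurve hHurwitz hLyapunov hB
    obtain ⟨l, hl, hlz⟩ := hz.mem_F 0
    have h0 : z 0 ∈ (SwitchedSystem.C B l).ker := hlz
    rw [hker l hl, Submodule.mem_bot] at h0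
    exact ne_zero_of_mem_unit_sphere ⟨z 0, hz.mem_sphere 0⟩ h0
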